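/- Let $S$ be a complex abelian variety with a polarization $L$. Let $\varphi_L : S \to \hat S = \mathrm{Pic}^0(S)$, $x \mapsto t_x^*L \otimes L^{-1}$, be the associated isogeny, and put $K(L) = \ker \varphi_L$. Let $u \in \mathrm{End}(S)$ be an endomorphism that is symmetric with respect to the Rosati involution, i.e. $\varphi_L u = \hat u \varphi_L$, where $\hat u \in \mathrm{End}(\hat S)$ is the dual endomorphism, and suppose that $u^2 = qu$ for some positive integer $q$. Consider the abelian subvarieties $A = \mathrm{im}(u)$ and $P = \mathrm{im}(q-u)$ of $S$, with the induced polarizations $L_A = L|A$ and $L_P = L|P$. (a) If $L_A = M^q$ for a polarization $M$ on $A$, then $K(M) = u(K(L))$ as subgroups of $A$. (b) If $L_P = N^q$ for a polarization $N$ on $P$, then $K(N) = (q-u)(K(L))$ as subgroups of $P$. Here a polarization is the class of a positive definite line bundle up to algebraic equivalence, and the equalities $L_A = M^q$ and $L_P = N^q$ are equalities of such classes. -/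

import Mathlib

/-!
Complex abelian varieties in the classical analytic language.  A complex torus is `V ⧸ Λ`, where
`V` is a finite-dimensional complex vector space and `Λ ⊆ V` is a lattice.  Holomorphic line bundles
on `V ⧸ Λ` are factors of automorphy modulo coboundaries (every holomorphic line bundle on `V` is
trivial), so that tensor product, pullback and translation are explicit operations.
-/

open scoped ComplexConjugate

noncomputable section

namespace AbVar

variable {V : Type*} [NormedAddCommGroup V] [NormedSpace ℂ V]
variable {W : Type*} [NormedAddCommGroup W] [NormedSpace ℂ W]

/-! ### Line bundles -/

/-- Factors of automorphy for `Λ`: families `f λ : V → ℂˣ` of nowhere vanishing holomorphic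
functions with `f (λ + μ) v = f λ (μ + v) * f μ v`.  The line bundle of `f` is the quotient of
`V × ℂ` by `λ • (v, t) = (v + λ, f λ v * t)`; the product of factors is the tensor product. -/
def Factor (Λ : Submodule ℤ V) : Subgroup (Λ → V → ℂˣ) where
  carrier := {f | (∀ l, Differentiable ℂ fun v => ((f l v : ℂˣ) : ℂ)) ∧
    ∀ l m v, f (l + m) v = f l ((m : V) + v) * f m v}
  one_mem' := ⟨fun _ => by simp, fun _ _ _ => by simp⟩
  mul_mem' := by
    rintro f g ⟨hf, hf'⟩ ⟨hg, hg'⟩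
    refine ⟨fun l => (hf l).mul (hg l), fun l m v => ?_⟩
    simp only [Pi.mul_apply, hf', hg']
    exact mul_mul_mul_comm _ _ _ _
  inv_mem' := by
    rintro f ⟨hf, hf'⟩
    refine ⟨fun l => by
      simp only [Pi.inv_apply, Units.val_inv_eq_inv_val]
      exact (hf l).inv (fun v => (f l v).ne_zero), fun l m v => ?_⟩
    simp only [Pi.inv_apply, hf', mul_inv]

/-- The coboundaries `(λ, v) ↦ h (v + λ) / h v`, with `h` holomorphic and nowhere zero: the factors
of automorphy of trivial line bundles. -/
def Coboundary (Λ : Submodule ℤ V) : Subgroup (Factor Λ) where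
  carrier := {f | ∃ h : V → ℂˣ, (Differentiable ℂ fun v => ((h v : ℂˣ) : ℂ)) ∧
    ∀ l v, f.1 l v = h (v + (l : V)) / h v}
  one_mem' := ⟨1, by simp, fun _ _ => by simp⟩
  mul_mem' := by
    rintro f g ⟨h, hh, hf⟩ ⟨k, hk, hg⟩
    refine ⟨h * k, hh.mul hk, fun l v => ?_⟩
    simp only [Subgroup.coe_mul, Pi.mul_apply, hf, hg]
    exact div_mul_div_comm _ _ _ _
  inv_mem' := by
    rintro f ⟨h, hh, hf⟩
    refine ⟨h⁻¹, by
      simp only [Pi.inv_apply, Units.val_inv_eq_inv_val]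
      exact hh.inv (fun v => (h v).ne_zero), fun l v => ?_⟩
    simp only [InvMemClass.coe_inv, Pi.inv_apply, hf, inv_div_inv, inv_div]

/-- The Picard group of `V ⧸ Λ`: isomorphism classes of holomorphic line bundles. -/
abbrev Pic (Λ : Submodule ℤ V) : Type _ := Factor Λ ⧸ Coboundary Λ

/-! ### Homomorphisms of complex tori -/

/-- Homomorphisms of complex tori `W ⧸ Γ → V ⧸ Λ`, given by their analytic representations:
`ℂ`-linear maps `W → V` which map `Γ` into `Λ`. -/
abbrev TorusHom (Γ : Submodule ℤ W) (Λ : Submodule ℤ V) : Type _ :=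
  {F : W →ₗ[ℂ] V // ∀ w ∈ Γ, F w ∈ Λ}

/-- The map on points `W ⧸ Γ → V ⧸ Λ` of a homomorphism of complex tori. -/
def TorusHom.onPoints {Γ : Submodule ℤ W} {Λ : Submodule ℤ V} (F : TorusHom Γ Λ) :
    W ⧸ Γ →+ V ⧸ Λ :=
  (Submodule.mapQ Γ Λ (F.1.restrictScalars ℤ) F.2).toAddMonoidHom

/-- The endomorphism ring of the complex torus `V ⧸ Λ`. -/
def EndRing (Λ : Submodule ℤ V) : Subring (Module.End ℂ V) where
  carrier := {F | ∀ v ∈ Λ, F v ∈ Λ}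
  one_mem' := fun _ hv => hv
  mul_mem' := fun hf hg v hv => hf _ (hg v hv)
  zero_mem' := fun _ _ => Λ.zero_mem
  add_mem' := fun hf hg v hv => Λ.add_mem (hf v hv) (hg v hv)
  neg_mem' := fun hf v hv => Λ.neg_mem (hf v hv)

/-- An endomorphism, viewed as a homomorphism. -/
def endHom {Λ : Submodule ℤ V} (u : EndRing Λ) : TorusHom Λ Λ := ⟨u.1, u.2⟩

/-! ### Pullback and translation of line bundles -/

/-- Pullback of factors of automorphy along a homomorphism. -/
def Factor.pullback [FiniteDimensional ℂ W] {Γ : Submodule ℤ W} {Λ : Submodule ℤ V}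
    (F : TorusHom Γ Λ) : Factor Λ →* Factor Γ where
  toFun f := ⟨fun l w => f.1 ⟨F.1 l, F.2 l l.2⟩ (F.1 w),
    fun l => (f.2.1 _).comp (LinearMap.toContinuousLinearMap F.1).differentiable,
    fun l m w => by
      have h := f.2.2 ⟨F.1 l, F.2 l l.2⟩ ⟨F.1 m, F.2 m m.2⟩ (F.1 w)
      simp only [map_add]
      rw [← h]
      simp⟩
  map_one' := rfl
  map_mul' _ _ := rfl

/-- Pullback `F^* : Pic (V ⧸ Λ) → Pic (W ⧸ Γ)` along a homomorphism `F`. -/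
def Pic.pullback [FiniteDimensional ℂ W] {Γ : Submodule ℤ W} {Λ : Submodule ℤ V}
    (F : TorusHom Γ Λ) : Pic Λ →* Pic Γ :=
  QuotientGroup.map _ _ (Factor.pullback F) (by
    rintro f ⟨h, hh, hf⟩
    refine ⟨fun w => h (F.1 w),
      hh.comp (LinearMap.toContinuousLinearMap F.1).differentiable, fun l w => ?_⟩
    simp only [map_add]
    exact hf _ _)

/-- Pullback of factors of automorphy along the translation `v ↦ v + x`. -/
def Factor.translate {Λ : Submodule ℤ V} (x : V) : Factor Λ →* Factor Λ where
  toFun f := ⟨fun l v => f.1 l (v + x),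
    fun l => (f.2.1 l).comp (differentiable_id.add_const x),
    fun l m v => by simp only [f.2.2, add_assoc]⟩
  map_one' := rfl
  map_mul' _ _ := rfl

/-- Pullback of line bundles along the translation by the image of `x` in `V ⧸ Λ`. -/
def Pic.translateAux {Λ : Submodule ℤ V} (x : V) : Pic Λ →* Pic Λ :=
  QuotientGroup.map _ _ (Factor.translate x) (by
    rintro f ⟨h, hh, hf⟩
    refine ⟨fun v => h (v + x), hh.comp (differentiable_id.add_const x), fun l v => ?_⟩
    simp only [add_right_comm v]
    exact hf _ _)

/-- The translation `t_x^* : Pic (V ⧸ Λ) → Pic (V ⧸ Λ)` by a point `x` of `V ⧸ Λ`. -/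
def Pic.translate {Λ : Submodule ℤ V} (x : V ⧸ Λ) : Pic Λ →* Pic Λ :=
  Quotient.liftOn' x Pic.translateAux (by
    intro x y hxy
    have hxy' : -x + y ∈ Λ := QuotientAddGroup.leftRel_apply.mp hxy
    refine MonoidHom.ext fun L => ?_
    induction L using QuotientGroup.induction_on with
    | H f =>
      refine QuotientGroup.eq.mpr ?_
      refine ⟨fun v => f.1 ⟨-x + y, hxy'⟩ (v + x),
        (f.2.1 _).comp (differentiable_id.add_const x), fun l v => ?_⟩
      have h1 := f.2.2 l ⟨-x + y, hxy'⟩ (v + x)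
      have h2 := f.2.2 ⟨-x + y, hxy'⟩ l (v + x)
      rw [add_comm, h1] at h2
      have e1 : -x + y + (v + x) = v + y := by abel
      have e2 : (l : V) + (v + x) = v + l + x := by abel
      simp only [e1, e2] at h2
      change (f.1 l (v + x))⁻¹ * f.1 l (v + y) = _
      simp only
      rw [eq_div_iff_mul_eq', mul_assoc, inv_mul_eq_iff_eq_mul, h2, mul_comm])

theorem Pic.translate_mk {Λ : Submodule ℤ V} (x : V) (f : Factor Λ) :
    Pic.translate (Submodule.Quotient.mk x : V ⧸ Λ) (QuotientGroup.mk f) =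
      QuotientGroup.mk (Factor.translate x f) := rfl

/-- `Pic⁰`, the dual torus: the line bundles invariant under all translations. -/
def Pic0 (Λ : Submodule ℤ V) : Subgroup (Pic Λ) where
  carrier := {L | ∀ x : V ⧸ Λ, Pic.translate x L = L}
  one_mem' := fun _ => map_one _
  mul_mem' := fun ha hb x => by rw [map_mul, ha x, hb x]
  inv_mem' := fun ha x => by rw [map_inv, ha x]

theorem Pic.translate_pullback [FiniteDimensional ℂ W] {Γ : Submodule ℤ W} {Λ : Submodule ℤ V}
    (F : TorusHom Γ Λ) (x : W ⧸ Γ) (L : Pic Λ) :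
    Pic.translate x (Pic.pullback F L) = Pic.pullback F (Pic.translate (F.onPoints x) L) := by
  induction x using Submodule.Quotient.induction_on with
  | H x =>
    induction L using QuotientGroup.induction_on with
    | H f =>
      refine congrArg QuotientGroup.mk (Subtype.ext ?_)
      funext l w
      exact congrArg _ (map_add F.1 w x)

/-- The dual homomorphism `F̂ : Pic⁰ (V ⧸ Λ) → Pic⁰ (W ⧸ Γ)`, i.e. pullback along `F`. -/
def TorusHom.dual [FiniteDimensional ℂ W] {Γ : Submodule ℤ W} {Λ : Submodule ℤ V}
    (F : TorusHom Γ Λ) : Pic0 Λ →* Pic0 Γ :=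
  ((Pic.pullback F).comp (Pic0 Λ).subtype).codRestrict (Pic0 Γ) fun L x =>
    (Pic.translate_pullback F x L.1).trans (congrArg _ (L.2 _))

/-- Algebraic (equivalently numerical) equivalence of line bundles: the difference is in `Pic⁰`.
A polarization, as opposed to a line bundle representing it, is determined up to this relation. -/
def AlgEquivalent {Λ : Submodule ℤ V} (L L' : Pic Λ) : Prop := L / L' ∈ Pic0 Λ

/-! ### Polarizations -/

/-- Appell–Humbert data: a Hermitian form `H` on `V` (linear in the first variable) whose imaginary
part is integral on `Λ`, with a semicharacter `χ` for it. -/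
structure AppellHumbert (Λ : Submodule ℤ V) where
  /-- the Hermitian form, which is the first Chern class -/
  H : V →ₗ[ℂ] V →ₗ⋆[ℂ] ℂ
  /-- the semicharacter -/
  χ : Λ → Circle
  hermitian : ∀ x y, H y x = conj (H x y)
  integral : ∀ l m : Λ, ∃ n : ℤ, (H l m).im = n
  semichar : ∀ l m : Λ, (χ (l + m) : ℂ) =
    χ l * χ m * Complex.exp (Real.pi * Complex.I * ((H l m).im : ℂ))

theorem AppellHumbert.cocycle {Λ : Submodule ℤ V} (D : AppellHumbert Λ) (l m : Λ) (v : V) :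
    (D.χ (l + m) : ℂ) * Complex.exp
        (Real.pi * D.H v (l + m : Λ) + Real.pi / 2 * D.H (l + m : Λ) (l + m : Λ)) =
      (D.χ l * Complex.exp (Real.pi * D.H ((m : V) + v) l + Real.pi / 2 * D.H l l)) *
      (D.χ m * Complex.exp (Real.pi * D.H v m + Real.pi / 2 * D.H m m)) := by
  obtain ⟨n, hn⟩ := D.integral l m
  have hs := D.semichar l m
  obtain ⟨r, hl, hm⟩ : ∃ r : ℝ, D.H (l : V) m = (r : ℂ) + (n : ℂ) * Complex.I ∧
      D.H (m : V) l = (r : ℂ) - (n : ℂ) * Complex.I := by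
    refine ⟨(D.H (l : V) m).re, ?_, ?_⟩
    · apply Complex.ext <;> simp [hn]
    · rw [D.hermitian (l : V) m]
      apply Complex.ext <;> simp [hn]
  rw [hs, hn]
  simp only [Submodule.coe_add, map_add, LinearMap.add_apply, hl, hm]
  have e : ∀ a b c d : ℂ, a * Complex.exp c * (b * Complex.exp d) =
      a * b * Complex.exp (c + d) := fun a b c d => by rw [Complex.exp_add]; ring
  rw [e, mul_assoc, ← Complex.exp_add]
  congr 1
  rw [Complex.exp_eq_exp_iff_exists_int]
  refine ⟨n, ?_⟩
  push_cast
  ring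

/-- The line bundle `L(H, χ)`, given by the canonical factor of automorphy
`χ(λ) exp(π H(v, λ) + (π/2) H(λ, λ))`. -/
def AppellHumbert.toFactor [FiniteDimensional ℂ V] {Λ : Submodule ℤ V} (D : AppellHumbert Λ) :
    Factor Λ :=
  ⟨fun l v => Units.mk0
      ((D.χ l : ℂ) * Complex.exp (Real.pi * D.H v l + Real.pi / 2 * D.H l l))
      (mul_ne_zero (Circle.coe_ne_zero _) (Complex.exp_ne_zero _)), by
    constructor
    · intro l
      simp only [Units.val_mk0]
      have h : Differentiable ℂ fun v : V => D.H v l :=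
        (LinearMap.toContinuousLinearMap (E := V) (F' := ℂ)
          { toFun := fun v => D.H v l
            map_add' := fun x y => by simp
            map_smul' := fun c x => by simp }).differentiable
      fun_prop
    · intro l m v
      apply Units.ext
      simpa using D.cocycle l m v⟩

/-- A polarization on `V ⧸ Λ`, given by a representing line bundle: a positive definite line bundle,
i.e. one isomorphic to some `L(H, χ)` with `H` positive definite.  (By the theorem of
Appell–Humbert, every line bundle is isomorphic to `L(H, χ)` for exactly one pair `(H, χ)`, and
`H` is its first Chern class.)  A complex torus is an abelian variety if it has a polarization. -/
structure Polarization [FiniteDimensional ℂ V] (Λ : Submodule ℤ V) where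
  /-- the line bundle -/
  toPic : Pic Λ
  posDef : ∃ D : AppellHumbert Λ, (∀ v, v ≠ 0 → 0 < (D.H v v).re) ∧
    toPic = QuotientGroup.mk D.toFactor

theorem AppellHumbert.translate_div_apply [FiniteDimensional ℂ V] {Λ : Submodule ℤ V}
    (D : AppellHumbert Λ) (x : V) (l : Λ) (v : V) :
    (((Factor.translate x D.toFactor / D.toFactor : Factor Λ).1 l v : ℂˣ) : ℂ) =
      Complex.exp (Real.pi * D.H x l) := by
  change (((Factor.translate x D.toFactor).1 l v / D.toFactor.1 l v : ℂˣ) : ℂ) = _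
  rw [Units.val_div_eq_div_val]
  change (D.χ l : ℂ) * Complex.exp (Real.pi * D.H (v + x) l + Real.pi / 2 * D.H l l) /
    ((D.χ l : ℂ) * Complex.exp (Real.pi * D.H v l + Real.pi / 2 * D.H l l)) = _
  rw [mul_div_mul_left _ _ (Circle.coe_ne_zero _), ← Complex.exp_sub]
  congr 1
  simp only [map_add, LinearMap.add_apply]
  ring

/-- The homomorphism `φ_L : V ⧸ Λ → Pic⁰ (V ⧸ Λ)`, `x ↦ t_x^* L ⊗ L⁻¹`, of a polarization. -/
def Polarization.phi [FiniteDimensional ℂ V] {Λ : Submodule ℤ V} (L : Polarization Λ) :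
    V ⧸ Λ →+ Additive (Pic0 Λ) where
  toFun x := Additive.ofMul ⟨Pic.translate x L.toPic / L.toPic, by
    obtain ⟨D, -, hD⟩ := L.posDef
    rw [hD]
    intro y
    induction x using Submodule.Quotient.induction_on with
    | H x =>
      induction y using Submodule.Quotient.induction_on with
      | H y =>
        refine congrArg QuotientGroup.mk (Subtype.ext ?_)
        funext l v
        apply Units.ext
        exact (D.translate_div_apply x l (v + y)).trans (D.translate_div_apply x l v).symm⟩
  map_zero' := by
    refine congrArg Additive.ofMul (Subtype.ext ?_)
    obtain ⟨D, -, hD⟩ := L.posDef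
    simp only [hD]
    refine congrArg QuotientGroup.mk (Subtype.ext ?_)
    funext l v
    apply Units.ext
    exact (D.translate_div_apply 0 l v).trans (by simp)
  map_add' x y := by
    refine congrArg Additive.ofMul (Subtype.ext ?_)
    obtain ⟨D, -, hD⟩ := L.posDef
    simp only [hD]
    induction x using Submodule.Quotient.induction_on with
    | H x =>
      induction y using Submodule.Quotient.induction_on with
      | H y =>
        refine congrArg QuotientGroup.mk (Subtype.ext ?_)
        funext l v
        apply Units.ext
        refine (D.translate_div_apply (x + y) l v).trans ?_
        refine Eq.trans ?_ (congrArg₂ (· * ·) (D.translate_div_apply x l v)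
          (D.translate_div_apply y l v)).symm
        simp only [← Complex.exp_add, map_add, LinearMap.add_apply, mul_add]

/-- `K(L) = ker φ_L`. -/
def Polarization.K [FiniteDimensional ℂ V] {Λ : Submodule ℤ V} (L : Polarization Λ) :
    AddSubgroup (V ⧸ Λ) := L.phi.ker

/-- `u` is symmetric for the Rosati involution of `L`: `φ_L u = û φ_L`. -/
def RosatiSymmetric [FiniteDimensional ℂ V] {Λ : Submodule ℤ V} (L : Polarization Λ)
    (u : EndRing Λ) : Prop :=
  L.phi.comp (endHom u).onPoints = (MonoidHom.toAdditive (endHom u).dual).comp L.phi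

/-! ### The image of an endomorphism -/

/-- The complex torus `im u`: its tangent space is the image of the analytic representation of `u`,
and its lattice is the intersection of `Λ` with that space. -/
def imLattice {Λ : Submodule ℤ V} (u : EndRing Λ) : Submodule ℤ (LinearMap.range u.1) :=
  Λ.comap ((LinearMap.range u.1).subtype.restrictScalars ℤ)

/-- The inclusion `im u → V ⧸ Λ`. -/
def imIncl {Λ : Submodule ℤ V} (u : EndRing Λ) : TorusHom (imLattice u) Λ :=
  ⟨(LinearMap.range u.1).subtype, fun _ h => h⟩

theorem imIncl_injective {Λ : Submodule ℤ V} (u : EndRing Λ) :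
    Function.Injective (imIncl u).onPoints := by
  rw [injective_iff_map_eq_zero]
  intro x hx
  induction x using Submodule.Quotient.induction_on with
  | H x =>
    refine (Submodule.Quotient.mk_eq_zero _).mpr ?_
    exact (Submodule.Quotient.mk_eq_zero Λ).mp hx

/-- The torus `im u` really is the image of `u` on points. -/
theorem imIncl_range {Λ : Submodule ℤ V} (u : EndRing Λ) :
    (imIncl u).onPoints.range = (endHom u).onPoints.range := by
  ext y
  constructor
  · rintro ⟨x, rfl⟩
    induction x using Submodule.Quotient.induction_on with
    | H x =>
      obtain ⟨x, v, rfl⟩ := x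
      exact ⟨Submodule.Quotient.mk v, rfl⟩
  · rintro ⟨x, rfl⟩
    induction x using Submodule.Quotient.induction_on with
    | H v => exact ⟨Submodule.Quotient.mk ⟨u.1 v, v, rfl⟩, rfl⟩

instance imLattice_discrete {Λ : Submodule ℤ V} [DiscreteTopology Λ] (u : EndRing Λ) :
    DiscreteTopology (imLattice u) :=
  DiscreteTopology.of_continuous_injective
    (f := fun x : imLattice u => (⟨x.1.1, x.2⟩ : Λ)) (by fun_prop) (fun x y h => by
      apply Subtype.ext; apply Subtype.ext; exact congrArg (fun z : Λ => (z : V)) h)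

instance imLattice_isZLattice {Λ : Submodule ℤ V} [DiscreteTopology Λ] [IsZLattice ℝ Λ]
    (u : EndRing Λ) : IsZLattice ℝ (imLattice u) := by
  refine ⟨?_⟩
  rw [eq_top_iff]
  rintro ⟨_, v, rfl⟩ -
  have hv : v ∈ Submodule.span ℝ (Λ : Set V) := by rw [IsZLattice.span_top]; trivial
  have h := Submodule.mem_map_of_mem (f := (LinearMap.rangeRestrict u.1).restrictScalars ℝ) hv
  rw [Submodule.map_span] at h
  refine Submodule.span_mono ?_ h
  rintro _ ⟨l, hl, rfl⟩
  exact u.2 l hl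

end AbVar

end

open scoped ComplexConjugate

namespace AbVar

section

variable {V : Type*} [NormedAddCommGroup V] [NormedSpace ℂ V] {Λ : Submodule ℤ V}

/-! ### Constant factors of automorphy -/

/-! Everything is read off the alternating form `E = Im H`. The bundle `t_x^* L ⊗ L⁻¹` has the
constant factor `exp (π H(x, λ))`, which is trivial exactly when `E(x, ·)` is integral on `Λ`
(`mem_coboundary_iff`), so `K(L)` is the `E`-dual lattice modulo `Λ`. Rosati symmetry says that `u`
is self-adjoint for `E`, and `L_A = M^q` says that `E = q E'` on the tangent space of `A`, where
`E'` is the form of `M`.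

If `x` represents a point of `K(L)`, then `q E'(ux, uv) = E(x, u²v) = q E(x, uv)`, so `E'(ux, ·)` is
integral on `Λ ∩ im u`. Conversely, let `E'(uw, ·)` be integral there. Since `Λ ∩ im u` is a direct
summand of `Λ` (`exists_extend_imLattice`), this functional extends to `Λ` and equals `E(x, ·)` for
some `x`; self-adjointness and nondegeneracy force `ux = uw` (`exists_apply_eq`). Part (b) is the
same statement for `q - u`. -/

/-- The function `exp (π conj (a v))` is holomorphic because `conj ∘ a` is `ℂ`-linear. Its
coboundary differs from `exp (π a(λ))` by `exp (2πi Im a(λ)) = 1`. -/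
theorem exists_exp_of_integral [FiniteDimensional ℂ V] (f : Factor Λ) (a : V →ₗ⋆[ℂ] ℂ)
    (hf : ∀ l v, ((f.1 l v : ℂˣ) : ℂ) = Complex.exp (Real.pi * a l))
    (ha : ∀ l : Λ, ∃ n : ℤ, (a l).im = n) : f ∈ Coboundary Λ := by
  have hd : Differentiable ℂ fun v : V => conj (a v) :=
    (LinearMap.toContinuousLinearMap (E := V) (F' := ℂ)
      { toFun := fun v => conj (a v)
        map_add' := fun x y => by simp
        map_smul' := fun c x => by simp }).differentiable
  refine ⟨fun v => Units.mk0 (Complex.exp (Real.pi * conj (a v))) (Complex.exp_ne_zero _),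
    ?_, fun l v => Units.ext ?_⟩
  · simp only [Units.val_mk0]
    fun_prop
  · obtain ⟨n, hn⟩ := ha l
    rw [hf, Units.val_div_eq_div_val, Units.val_mk0, Units.val_mk0, ← Complex.exp_sub,
      Complex.exp_eq_exp_iff_exists_int]
    refine ⟨n, ?_⟩
    have h1 : a l = conj (a l) + 2 * n * Complex.I := by
      apply Complex.ext <;> simp [hn]; ring
    rw [map_add, map_add]
    linear_combination (Real.pi : ℂ) * h1

/-- Dividing a trivialization by `exp (π conj (a v))` leaves an entire function `k` with unitary
multipliers `exp (2πi Im a(λ))`. Then `‖k‖` is periodic, hence bounded, so `k` is constant by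
Liouville and the multipliers are 1. -/
theorem integral_of_mem_coboundary [FiniteDimensional ℂ V] [DiscreteTopology Λ] [IsZLattice ℝ Λ]
    (f : Factor Λ) (a : V →ₗ⋆[ℂ] ℂ)
    (hf : ∀ l v, ((f.1 l v : ℂˣ) : ℂ) = Complex.exp (Real.pi * a l))
    (h : f ∈ Coboundary Λ) (l : Λ) : ∃ n : ℤ, (a l).im = n := by
  obtain ⟨h, hh, hc⟩ := h
  have hd : Differentiable ℂ fun v : V => conj (a v) :=
    (LinearMap.toContinuousLinearMap (E := V) (F' := ℂ)
      { toFun := fun v => conj (a v)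
        map_add' := fun x y => by simp
        map_smul' := fun c x => by simp }).differentiable
  set k : V → ℂ := fun v => (h v : ℂ) * Complex.exp (-(Real.pi * conj (a v))) with hk
  have hkd : Differentiable ℂ k := by fun_prop
  have hper : ∀ (m : Λ) (v : V),
      k (v + m) = k v * Complex.exp ((2 * Real.pi * (a m).im : ℝ) * Complex.I) := by
    intro m v
    have h1 : (h (v + m) : ℂ) = h v * Complex.exp (Real.pi * a m) := by
      rw [← hf m v, hc m v, Units.val_div_eq_div_val, mul_div_cancel₀ _ (h v).ne_zero]
    simp only [hk]
    rw [h1, mul_assoc, mul_assoc, ← Complex.exp_add, ← Complex.exp_add]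
    congr 2
    have h2 : a m = conj (a m) + 2 * (a m).im * Complex.I := by
      apply Complex.ext <;> simp; ring
    rw [map_add, map_add]
    push_cast
    linear_combination (Real.pi : ℂ) * h2
  have hcomp : IsCompact (Set.range fun v => ‖k v‖) := by
    refine IsZLattice.isCompact_range_of_periodic Λ _ hkd.continuous.norm fun z w hw => ?_
    rw [hper ⟨w, hw⟩ z, norm_mul, Complex.norm_exp_ofReal_mul_I, mul_one]
  have hb : Bornology.IsBounded (Set.range k) := by
    obtain ⟨C, hC⟩ := hcomp.bddAbove
    refine isBounded_iff_forall_norm_le.mpr ⟨C, ?_⟩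
    rintro _ ⟨v, rfl⟩
    exact hC ⟨v, rfl⟩
  have h0 := hper l 0
  rw [hkd.apply_eq_apply_of_bounded hb (0 + l) 0] at h0
  have hk0 : k 0 ≠ 0 := mul_ne_zero (h 0).ne_zero (Complex.exp_ne_zero _)
  have h1 : Complex.exp ((2 * Real.pi * (a l).im : ℝ) * Complex.I) = 1 :=
    mul_left_cancel₀ hk0 (by rw [← h0, mul_one])
  obtain ⟨n, hn⟩ := Complex.exp_eq_one_iff.mp h1
  refine ⟨n, ?_⟩
  have h2 := congrArg Complex.im hn
  simp at h2
  have h3 : (2 * Real.pi) * ((a l).im - n) = 0 := by linarith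
  have h4 := (mul_eq_zero.mp h3).resolve_left (by positivity)
  linarith

/-- A factor of automorphy `exp (π a(λ))` with `a` antilinear is trivial if and only if
`Im a` is integral on the lattice. -/
theorem mem_coboundary_iff [FiniteDimensional ℂ V] [DiscreteTopology Λ] [IsZLattice ℝ Λ]
    (f : Factor Λ) (a : V →ₗ⋆[ℂ] ℂ)
    (hf : ∀ l v, ((f.1 l v : ℂˣ) : ℂ) = Complex.exp (Real.pi * a l)) :
    f ∈ Coboundary Λ ↔ ∀ l : Λ, ∃ n : ℤ, (a l).im = n :=
  ⟨integral_of_mem_coboundary f a hf, exists_exp_of_integral f a hf⟩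

theorem eq_zero_of_forall_mul_int {c : ℝ} (h : ∀ t : ℝ, ∃ n : ℤ, t * c = n) : c = 0 := by
  by_contra hc
  -- This multiple of `c` is `1/2`, which is not an integer.
  obtain ⟨n, hn⟩ := h (1 / (2 * c))
  have h1 : (2 * n : ℝ) = 1 := by rw [← hn]; field_simp
  have h2 : 2 * n = 1 := by exact_mod_cast h1
  omega

/-! ### The alternating form -/

/-- The imaginary part of the Hermitian form. -/
noncomputable def AppellHumbert.im (D : AppellHumbert Λ) : V →ₗ[ℝ] V →ₗ[ℝ] ℝ :=
  LinearMap.mk₂ ℝ (fun x y => (D.H x y).im) (fun x y z => by simp)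
    (fun c x y => by simp [← Complex.coe_smul])
    (fun x y z => by simp) (fun c x y => by simp [← Complex.coe_smul])

theorem AppellHumbert.im_apply (D : AppellHumbert Λ) (x y : V) : D.im x y = (D.H x y).im := rfl

theorem AppellHumbert.im_surjective [FiniteDimensional ℂ V] (D : AppellHumbert Λ)
    (hD : ∀ v, v ≠ 0 → 0 < (D.H v v).re) : Function.Surjective D.im := by
  have hinj : Function.Injective D.im := by
    rw [injective_iff_map_eq_zero]
    intro x hx
    by_contra h0
    -- As `H` is antilinear in the second variable, `E(x, ix) = -Re H(x, x)`.
    have h1 : D.im x (Complex.I • x) = 0 := by rw [hx]; rfl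
    have h2 := hD x h0
    rw [D.im_apply, LinearMap.map_smulₛₗ] at h1
    simp at h1
    linarith
  exact (LinearMap.injective_iff_surjective_of_finrank_eq_finrank
    (Subspace.dual_finrank_eq (K := ℝ) (V := V)).symm).mp hinj

theorem Polarization.mem_K_iff [FiniteDimensional ℂ V] [DiscreteTopology Λ] [IsZLattice ℝ Λ]
    (L : Polarization Λ) (D : AppellHumbert Λ) (hL : L.toPic = QuotientGroup.mk D.toFactor)
    (x : V) : (Submodule.Quotient.mk x : V ⧸ Λ) ∈ L.K ↔ ∀ l : Λ, ∃ n : ℤ, D.im x l = n := by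
  have h1 : (Submodule.Quotient.mk x : V ⧸ Λ) ∈ L.K ↔
      Pic.translate (Submodule.Quotient.mk x : V ⧸ Λ) L.toPic / L.toPic = 1 := by
    refine Iff.trans (AddMonoidHom.mem_ker) ?_
    exact Subtype.ext_iff (a1 := (⟨_, _⟩ : Pic0 Λ)) (a2 := 1)
  rw [h1, hL, Pic.translate_mk]
  refine Iff.trans (QuotientGroup.eq_one_iff (Factor.translate x D.toFactor / D.toFactor)) ?_
  exact mem_coboundary_iff _ (D.H x) fun l v => D.translate_div_apply x l v

/-! ### Algebraic equivalence and Rosati symmetry in terms of Hermitian forms -/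

theorem translate_div_mem_coboundary {g : Factor Λ} (hg : (QuotientGroup.mk g : Pic Λ) ∈ Pic0 Λ)
    (y : V) : Factor.translate y g / g ∈ Coboundary Λ :=
  (QuotientGroup.eq_one_iff _).mp
    ((QuotientGroup.mk_div _ _ _).trans (div_eq_one.mpr (hg (Submodule.Quotient.mk y))))

theorem translate_div_pullback_apply {W : Type*} [NormedAddCommGroup W] [NormedSpace ℂ W]
    [FiniteDimensional ℂ W] {Γ : Submodule ℤ W} (F : TorusHom Γ Λ) (f : Factor Λ) (f' : Factor Γ)
    (q : ℕ) (y : W) (m : Γ) (v : W) :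
    (((Factor.translate y (Factor.pullback F f / f' ^ q) /
        (Factor.pullback F f / f' ^ q) : Factor Γ).1 m v : ℂˣ) : ℂ) =
      (((Factor.translate (F.1 y) f / f : Factor Λ).1 ⟨F.1 m, F.2 m m.2⟩ (F.1 v) : ℂˣ) : ℂ) /
        (((Factor.translate y f' / f' : Factor Γ).1 m v : ℂˣ) : ℂ) ^ q := by
  change (((f.1 ⟨F.1 m, F.2 m m.2⟩ (F.1 (v + y)) / f'.1 m (v + y) ^ q) /
    (f.1 ⟨F.1 m, F.2 m m.2⟩ (F.1 v) / f'.1 m v ^ q) : ℂˣ) : ℂ) =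
    ((f.1 ⟨F.1 m, F.2 m m.2⟩ (F.1 v + F.1 y) / f.1 ⟨F.1 m, F.2 m m.2⟩ (F.1 v) : ℂˣ) : ℂ) /
      ((f'.1 m (v + y) / f'.1 m v : ℂˣ) : ℂ) ^ q
  rw [← Units.val_pow_eq_pow_val, ← Units.val_div_eq_div_val, map_add, div_pow, div_div_div_comm]

/-- Membership in `Pic⁰` only gives that `E(Fy, Fl) - q E'(y, l)` is an integer, but for every
vector `y`. Being real-linear in `y`, it vanishes. -/
theorem im_eq_of_algEquivalent {W : Type*} [NormedAddCommGroup W] [NormedSpace ℂ W]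
    [FiniteDimensional ℂ V] [FiniteDimensional ℂ W] {Γ : Submodule ℤ W}
    [DiscreteTopology Γ] [IsZLattice ℝ Γ] (F : TorusHom Γ Λ) (D : AppellHumbert Λ)
    (D' : AppellHumbert Γ) (q : ℕ)
    (h : AlgEquivalent (Pic.pullback F (QuotientGroup.mk D.toFactor))
      ((QuotientGroup.mk D'.toFactor : Pic Γ) ^ q)) (x : W) (l : Γ) :
    D.im (F.1 x) (F.1 l) = q * D'.im x l := by
  have key : ∀ y : W, ∃ n : ℤ, D.im (F.1 y) (F.1 l) - q * D'.im y l = n := by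
    intro y
    let g : Factor Γ := Factor.pullback F D.toFactor / D'.toFactor ^ q
    have h1 : (QuotientGroup.mk g : Pic Γ) ∈ Pic0 Γ := by
      rw [QuotientGroup.mk_div, QuotientGroup.mk_pow]
      exact h
    have h3 := integral_of_mem_coboundary (Factor.translate y g / g)
      ((D.H (F.1 y)).comp F.1 - (q : ℂ) • D'.H y) ?_ (translate_div_mem_coboundary h1 y) l
    · simpa [AppellHumbert.im_apply] using h3
    · intro m v
      refine (translate_div_pullback_apply F D.toFactor D'.toFactor q y m v).trans ?_
      refine (congrArg₂ (fun a b : ℂ => a / b ^ q)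
        (D.translate_div_apply (F.1 y) ⟨F.1 m, F.2 m m.2⟩ (F.1 v))
        (D'.translate_div_apply y m v)).trans ?_
      simp only
      rw [← Complex.exp_nat_mul, ← Complex.exp_sub]
      congr 1
      simp
      ring
  refine sub_eq_zero.mp (eq_zero_of_forall_mul_int fun t => ?_)
  obtain ⟨n, hn⟩ := key ((t : ℂ) • x)
  refine ⟨n, ?_⟩
  rw [← hn, map_smul, Complex.coe_smul, Complex.coe_smul, map_smul, map_smul]
  simp only [LinearMap.smul_apply, smul_eq_mul]
  ring

/-- Comparing the factors of `φ_L(ux)` and `û φ_L(x)` gives equality modulo integers on `Λ`. Real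
scaling of `x` removes the integers, and `Λ` spans `V` over `ℝ`. -/
theorem im_symm_of_rosatiSymmetric [FiniteDimensional ℂ V] [DiscreteTopology Λ] [IsZLattice ℝ Λ]
    (L : Polarization Λ) (D : AppellHumbert Λ) (hL : L.toPic = QuotientGroup.mk D.toFactor)
    (u : EndRing Λ) (hu : RosatiSymmetric L u) (x y : V) :
    D.im (u.1 x) y = D.im x (u.1 y) := by
  have key : ∀ (x : V) (l : Λ), ∃ n : ℤ, D.im (u.1 x) l - D.im x (u.1 l) = n := by
    intro x l
    have h0 := DFunLike.congr_fun hu (Submodule.Quotient.mk x : V ⧸ Λ)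
    have h1 : Pic.translate (Submodule.Quotient.mk (u.1 x) : V ⧸ Λ) L.toPic / L.toPic =
        Pic.pullback (endHom u)
          (Pic.translate (Submodule.Quotient.mk x : V ⧸ Λ) L.toPic / L.toPic) :=
      congrArg (fun z : Additive (Pic0 Λ) => (Additive.toMul z).1) h0
    rw [hL] at h1
    set g : Factor Λ := (Factor.translate (u.1 x) D.toFactor / D.toFactor) /
      Factor.pullback (endHom u) (Factor.translate x D.toFactor / D.toFactor) with hg
    have h2 : (QuotientGroup.mk g : Pic Λ) = 1 := div_eq_one.mpr h1
    have h3 := integral_of_mem_coboundary g (D.H (u.1 x) - (D.H x).comp u.1) ?_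
      ((QuotientGroup.eq_one_iff _).mp h2) l
    · simpa [AppellHumbert.im_apply] using h3
    · intro m v
      rw [hg]
      change ((_ / _ : ℂˣ) : ℂ) = _
      rw [Units.val_div_eq_div_val]
      refine (congrArg₂ (fun a b : ℂ => a / b) (D.translate_div_apply (u.1 x) m v)
        (D.translate_div_apply x ⟨u.1 m, u.2 m m.2⟩ (u.1 v))).trans ?_
      simp only
      rw [← Complex.exp_sub]
      congr 1
      simp
      ring
  have hl : ∀ l : Λ, D.im (u.1 x) l = D.im x (u.1 l) := by
    intro l
    refine sub_eq_zero.mp (eq_zero_of_forall_mul_int fun t => ?_)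
    obtain ⟨n, hn⟩ := key ((t : ℂ) • x) l
    refine ⟨n, ?_⟩
    rw [← hn, map_smul, Complex.coe_smul, Complex.coe_smul, map_smul, map_smul]
    simp only [LinearMap.smul_apply, smul_eq_mul]
    ring
  have hy : y ∈ Submodule.span ℝ (Λ : Set V) := by rw [IsZLattice.span_top]; trivial
  induction hy using Submodule.span_induction with
  | mem y hy => exact hl ⟨y, hy⟩
  | zero => simp
  | add y z _ _ h1 h2 => rw [map_add, map_add, map_add, h1, h2]
  | smul c y _ h =>
    rw [map_smul, h, ← Complex.coe_smul c y, map_smul, Complex.coe_smul, map_smul]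

/-! ### Extending integral functionals -/

theorem quad_apply {u : EndRing Λ} {q : ℕ} (h : u ^ 2 = (q : EndRing Λ) * u) (v : V) :
    u.1 (u.1 v) = (q : ℝ) • u.1 v := by
  have h1 := congrArg (fun w : EndRing Λ => w.1 v) h
  rw [pow_two] at h1
  refine h1.trans ?_
  rw [Nat.cast_smul_eq_nsmul]
  simp

/-- An additive map on `Λ ∩ im u` extends to `Λ`. -/
theorem exists_extend_imLattice [DiscreteTopology Λ] [FiniteDimensional ℂ V]
    (u : EndRing Λ) (q : ℕ) (hq : 0 < q) (h : u ^ 2 = (q : EndRing Λ) * u)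
    (f : imLattice u →ₗ[ℤ] ℤ) :
    ∃ g : Λ →ₗ[ℤ] ℤ, ∀ l : imLattice u, g ⟨l.1.1, l.2⟩ = f l := by
  -- `T` is `q - u` on `Λ`, with kernel `Λ ∩ im u`. Its range is a subgroup of a lattice, hence
  -- free, so `T` splits onto its range.
  let T : Λ →ₗ[ℤ] Λ :=
    { toFun := fun l => (q : ℤ) • l - ⟨u.1 l, u.2 l l.2⟩
      map_add' := fun x y => by
        apply Subtype.ext
        simp only [Submodule.coe_add, Submodule.coe_sub, Submodule.coe_smul, map_add, smul_add]
        abel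
      map_smul' := fun c x => by
        apply Subtype.ext
        simp only [Submodule.coe_sub, Submodule.coe_smul, map_zsmul, RingHom.id_apply, smul_sub]
        rw [smul_comm] }
  obtain ⟨s, hs⟩ := T.rangeRestrict.exists_rightInverse_of_surjective T.range_rangeRestrict
  have hT : ∀ l : Λ, T l = 0 → (l : V) ∈ LinearMap.range u.1 := by
    intro l hl
    have h1 : (q : ℤ) • (l : V) - u.1 l = 0 := congrArg Subtype.val hl
    refine ⟨((q : ℂ)⁻¹) • (l : V), ?_⟩
    rw [map_smul, ← sub_eq_zero.mp h1, natCast_zsmul, ← Nat.cast_smul_eq_nsmul ℂ, smul_smul,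
      inv_mul_cancel₀ (by exact_mod_cast hq.ne'), one_smul]
  have hT' : ∀ l : imLattice u, T ⟨l.1.1, l.2⟩ = 0 := by
    rintro ⟨⟨_, v, rfl⟩, hl⟩
    apply Subtype.ext
    change (q : ℤ) • u.1 v - u.1 (u.1 v) = 0
    rw [quad_apply h, natCast_zsmul, Nat.cast_smul_eq_nsmul, sub_self]
  have hp : ∀ l : Λ, T (l - s (T.rangeRestrict l)) = 0 := by
    intro l
    have h1 := congrArg Subtype.val (DFunLike.congr_fun hs (T.rangeRestrict l))
    change T (s (T.rangeRestrict l)) = T l at h1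
    rw [map_sub, h1, sub_self]
  -- The projection `1 - sT` of `Λ` onto `ker T`.
  let p : Λ →ₗ[ℤ] imLattice u :=
    { toFun := fun l => ⟨⟨_, hT _ (hp l)⟩, (l - s (T.rangeRestrict l)).2⟩
      map_add' := fun x y => by
        apply Subtype.ext
        apply Subtype.ext
        simp only [map_add, Submodule.coe_add, Submodule.coe_sub]
        abel
      map_smul' := fun c x => by
        apply Subtype.ext
        apply Subtype.ext
        simp only [map_smul, RingHom.id_apply]
        exact (smul_sub c (x : V) (s (T.rangeRestrict x))).symm }
  refine ⟨f.comp p, fun l => congrArg f (Subtype.ext (Subtype.ext ?_))⟩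
  have h1 : T.rangeRestrict ⟨l.1.1, l.2⟩ = 0 := Subtype.ext (hT' l)
  change ((⟨l.1.1, l.2⟩ - s (T.rangeRestrict ⟨l.1.1, l.2⟩) : Λ) : V) = l.1.1
  rw [h1, map_zero, sub_zero]

/-- An integral functional on `Λ` extends `ℝ`-linearly to `V`, and nondegeneracy of `E` represents
it by a vector. -/
theorem exists_im_eq [FiniteDimensional ℂ V] [DiscreteTopology Λ] [IsZLattice ℝ Λ]
    (D : AppellHumbert Λ) (hD : ∀ v, v ≠ 0 → 0 < (D.H v v).re) (g : Λ →ₗ[ℤ] ℤ) :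
    ∃ x : V, ∀ l : Λ, D.im x l = g l := by
  let b := Module.Free.chooseBasis ℤ Λ
  obtain ⟨x, hx⟩ := D.im_surjective hD
    ((b.ofZLatticeBasis ℝ Λ).constr ℝ fun i => (g (b i) : ℝ))
  refine ⟨x, fun l => ?_⟩
  let A : Λ →ₗ[ℤ] ℝ := ((D.im x).restrictScalars ℤ).comp Λ.subtype
  let B : Λ →ₗ[ℤ] ℝ := (Int.castAddHom ℝ).toIntLinearMap.comp g
  have hAB : A = B := b.ext fun i => by
    change D.im x (b i) = (g (b i) : ℝ)
    rw [hx, ← b.ofZLatticeBasis_apply ℝ Λ i, Module.Basis.constr_basis]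
  exact DFunLike.congr_fun hAB l

theorem exists_apply_eq [FiniteDimensional ℂ V] [DiscreteTopology Λ] [IsZLattice ℝ Λ]
    (D : AppellHumbert Λ) (hD : ∀ v, v ≠ 0 → 0 < (D.H v v).re)
    (u : EndRing Λ) (hu : ∀ x y, D.im (u.1 x) y = D.im x (u.1 y))
    (q : ℕ) (hq : 0 < q) (h : u ^ 2 = (q : EndRing Λ) * u) (w : V)
    (f : imLattice u →ₗ[ℤ] ℤ) (hf : ∀ l : imLattice u, D.im (u.1 w) l.1.1 = q * f l) :
    ∃ x : V, (∀ l : Λ, ∃ n : ℤ, D.im x l = n) ∧ u.1 x = u.1 w := by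
  obtain ⟨g, hg⟩ := exists_extend_imLattice u q hq h f
  obtain ⟨x, hx⟩ := exists_im_eq D hD g
  refine ⟨x, fun l => ⟨g l, hx l⟩, ?_⟩
  have hq' : (q : ℝ) ≠ 0 := by exact_mod_cast hq.ne'
  -- Here `E(ux, l) = E(x, ul) = f(ul)`, while `q E(uw, l) = E(u²w, l) = E(uw, ul) = q f(ul)`.
  have hl : ∀ l : Λ, D.im (u.1 x - u.1 w) l = 0 := by
    intro l
    let m : imLattice u := ⟨⟨u.1 l, l, rfl⟩, u.2 l l.2⟩
    have h1 : D.im (u.1 x) l = f m := by rw [hu, ← hg m]; exact hx ⟨u.1 l, u.2 l l.2⟩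
    have h2 : D.im (u.1 w) (u.1 l) = q * f m := hf m
    rw [← hu, quad_apply h, map_smul, LinearMap.smul_apply, smul_eq_mul] at h2
    rw [map_sub, LinearMap.sub_apply, h1, mul_left_cancel₀ hq' h2, sub_self]
  by_contra hne
  have hne' : u.1 x - u.1 w ≠ 0 := sub_ne_zero.mpr hne
  have hz : ∀ y : V, D.im (u.1 x - u.1 w) y = 0 := by
    intro y
    have hy : y ∈ Submodule.span ℝ (Λ : Set V) := by rw [IsZLattice.span_top]; trivial
    induction hy using Submodule.span_induction with
    | mem y hy => exact hl ⟨y, hy⟩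
    | zero => simp
    | add y z _ _ h1 h2 => rw [map_add, h1, h2, add_zero]
    | smul c y _ h => rw [map_smul, h, smul_zero]
  have h1 := hz (Complex.I • (u.1 x - u.1 w))
  have h2 := hD _ hne'
  rw [D.im_apply, LinearMap.map_smulₛₗ] at h1
  simp only [smul_eq_mul, Complex.conj_I, neg_mul, Complex.neg_im, Complex.I_mul_im] at h1
  linarith

/-! ### The kernel of the polarization on the image of a symmetric endomorphism -/

theorem map_K_eq [FiniteDimensional ℂ V] [DiscreteTopology Λ] [IsZLattice ℝ Λ]
    (L : Polarization Λ) (D : AppellHumbert Λ) (hL : L.toPic = QuotientGroup.mk D.toFactor)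
    (hD : ∀ v, v ≠ 0 → 0 < (D.H v v).re)
    (u : EndRing Λ) (hu : ∀ x y, D.im (u.1 x) y = D.im x (u.1 y))
    (q : ℕ) (hq : 0 < q) (h : u ^ 2 = (q : EndRing Λ) * u) (M : Polarization (imLattice u))
    (hM : AlgEquivalent (Pic.pullback (imIncl u) L.toPic) (M.toPic ^ q)) :
    M.K.map (imIncl u).onPoints = L.K.map (endHom u).onPoints := by
  obtain ⟨D', -, hM'⟩ := M.posDef
  rw [hL, hM'] at hM
  have him := im_eq_of_algEquivalent (imIncl u) D D' q hM
  have hq' : (q : ℝ) ≠ 0 := by exact_mod_cast hq.ne'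
  ext y
  constructor
  · rintro ⟨a, ha, rfl⟩
    induction a using Submodule.Quotient.induction_on with
    | H a =>
      have ha' := (M.mem_K_iff D' hM' a).mp ha
      obtain ⟨_, w, rfl⟩ := a
      choose f hf using ha'
      let f' : imLattice u →ₗ[ℤ] ℤ := AddMonoidHom.toIntLinearMap
        { toFun := f
          map_zero' := by
            have h0 := hf 0
            simp only [ZeroMemClass.coe_zero, map_zero] at h0
            exact_mod_cast h0.symm
          map_add' := fun l m => by
            have h1 : (f (l + m) : ℝ) = f l + f m := by
              rw [← hf, ← hf, ← hf, Submodule.coe_add, map_add]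
            exact_mod_cast h1 }
      obtain ⟨x, hx, hxw⟩ := exists_apply_eq D hD u hu q hq h w f' fun l =>
        (him ⟨u.1 w, w, rfl⟩ l).trans (congrArg _ (hf l))
      exact ⟨Submodule.Quotient.mk x, (L.mem_K_iff D hL x).mpr hx,
        congrArg (Submodule.Quotient.mk (p := Λ)) hxw⟩
  · rintro ⟨x, hx, rfl⟩
    induction x using Submodule.Quotient.induction_on with
    | H x =>
      have hx' := (L.mem_K_iff D hL x).mp hx
      refine ⟨Submodule.Quotient.mk ⟨u.1 x, x, rfl⟩, (M.mem_K_iff D' hM' _).mpr ?_, rfl⟩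
      -- Only `uv` lies in `Λ`; `v` itself is an arbitrary vector.
      rintro ⟨⟨_, v, rfl⟩, hl⟩
      obtain ⟨n, hn⟩ := hx' ⟨u.1 v, hl⟩
      refine ⟨n, ?_⟩
      have h1 := him ⟨u.1 x, x, rfl⟩ ⟨⟨u.1 v, v, rfl⟩, hl⟩
      change D.im (u.1 x) (u.1 v) = _ at h1
      rw [hu, quad_apply h, map_smul, smul_eq_mul] at h1
      rw [← hn]
      exact (mul_left_cancel₀ hq' h1).symm

end

end AbVar

/-- Both parts are instances of `map_K_eq`, since `q - u` is again self-adjoint for `E` and `(q -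
u)² = q(q - u)`. -/
theorem proposition2p10 {V : Type*} [NormedAddCommGroup V] [NormedSpace ℂ V]
    [FiniteDimensional ℂ V] (Λ : Submodule ℤ V) [DiscreteTopology Λ] [IsZLattice ℝ Λ]
    (L : AbVar.Polarization Λ) (u : AbVar.EndRing Λ) (hu : AbVar.RosatiSymmetric L u)
    (q : ℕ) (hq : 0 < q) (hquad : u ^ 2 = (q : AbVar.EndRing Λ) * u) :
    (∀ M : AbVar.Polarization (AbVar.imLattice u),
      AbVar.AlgEquivalent (AbVar.Pic.pullback (AbVar.imIncl u) L.toPic) (M.toPic ^ q) →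
      M.K.map (AbVar.imIncl u).onPoints = L.K.map (AbVar.endHom u).onPoints) ∧
    (∀ N : AbVar.Polarization (AbVar.imLattice ((q : AbVar.EndRing Λ) - u)),
      AbVar.AlgEquivalent
        (AbVar.Pic.pullback (AbVar.imIncl ((q : AbVar.EndRing Λ) - u)) L.toPic) (N.toPic ^ q) →
      N.K.map (AbVar.imIncl ((q : AbVar.EndRing Λ) - u)).onPoints =
        L.K.map (AbVar.endHom ((q : AbVar.EndRing Λ) - u)).onPoints) := by
  obtain ⟨D, hD, hL⟩ := L.posDef
  have hsymm := AbVar.im_symm_of_rosatiSymmetric L D hL u hu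
  refine ⟨AbVar.map_K_eq L D hL hD u hsymm q hq hquad,
    AbVar.map_K_eq L D hL hD _ (fun x y => ?_) q hq ?_⟩
  · have hv : ∀ z : V, ((q : AbVar.EndRing Λ) - u).1 z = (q : ℝ) • z - u.1 z := fun z => by
      rw [Nat.cast_smul_eq_nsmul]
      simp
    rw [hv, hv, map_sub, map_sub, LinearMap.sub_apply, hsymm, map_smul, map_smul,
      LinearMap.smul_apply]
  · have hc : u * (q : AbVar.EndRing Λ) = (q : AbVar.EndRing Λ) * u :=
      ((Nat.cast_commute q u).eq).symm
    rw [pow_two] at hquad ⊢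
    rw [mul_sub, sub_mul _ _ u, hquad, sub_self, sub_zero, sub_mul, mul_sub, hc]
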